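/- Let $(X,\|\cdot\|)$ be a Banach space, $a<b$ real numbers, $0<\alpha<1$, $0<\beta<1$, $f\in C^{1}([a,b],X)$, let $m\ge 1$ be an integer, and let $n\ge 1$ be an integer with $n^{1-\beta}>2$ and $\lceil na\rceil\le\lfloor nb\rfloor$. Put $$\varphi(x)=\frac{x}{\sqrt[2m]{1+x^{2m}}},\qquad \Phi(x)=\tfrac14\left[\varphi(x+1)-\varphi(x-1)\right],\qquad A_n(f,x)=\frac{\sum_{k=\lceil na\rceil}^{\lfloor nb\rfloor} f\left(\frac kn\right)\Phi(nx-k)}{\sum_{k=\lceil na\rceil}^{\lfloor nb\rfloor}\Phi(nx-k)}\quad(x\in[a,b]).$$ For $x\in[a,b]$ define the left and right Caputo–Bochner derivatives of order $\alpha$ based at $x$ by $$(D_{*x}^{\alpha}f)(y)=\frac{1}{\Gamma(1-\alpha)}\int_x^y (y-t)^{-\alpha}f'(t)\,dt\quad(y\in[x,b]),\qquad (D_{x-}^{\alpha}f)(y)=\frac{-1}{\Gamma(1-\alpha)}\int_y^x (z-y)^{-\alpha}f'(z)\,dz\quad(y\in[a,x]).$$ For an interval $S$, a function $g:S\to X$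 and $\delta>0$ write $\|g\|_{\infty,S}=\sup_{y\in S}\|g(y)\|$ and $\omega_1(g,\delta)_S=\sup\{\|g(y)-g(z)\|: y,z\in S,\ |y-z|\le\delta\}$. Then all the suprema below are finite, and (i) for every $x\in[a,b]$, $$\|A_n(f,x)-f(x)\|\le\frac{2\sqrt[2m]{1+4^m}}{\Gamma(\alpha+1)}\left\{\frac{\omega_1\left(D_{x-}^{\alpha}f,\frac1{n^\beta}\right)_{[a,x]}+\omega_1\left(D_{*x}^{\alpha}f,\frac1{n^\beta}\right)_{[x,b]}}{n^{\alpha\beta}}+\frac{\|D_{x-}^{\alpha}f\|_{\infty,[a,x]}(x-a)^\alpha+\|D_{*x}^{\alpha}f\|_{\infty,[x,b]}(b-x)^\alpha}{4m\,(n^{1-\beta}-2)^{2m}}\right\};$$ (ii) $$\|A_nf-f\|_{\infty,[a,b]}\le\frac{2\sqrt[2m]{1+4^m}}{\Gamma(\alpha+1)}\left\{\frac{\sup_{x\in[a,b]}\omega_1\left(D_{x-}^{\alpha}f,\frac1{n^\beta}\right)_{[a,x]}+\sup_{x\in[a,b]}\omega_1\left(D_{*x}^{\alpha}f,\frac1{n^\beta}\right)_{[x,b]}}{n^{\alpha\beta}}+\frac{(b-a)^\alpha}{4m\,(n^{1-\beta}-2)^{2m}}\left(\sup_{x\in[a,b]}\|D_{x-}^{\alpha}f\|_{\infty,[a,x]}+\sup_{x\in[a,b]}\|D_{*x}^{\alpha}f\|_{\infty,[x,b]}\right)\right\}.$$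 -/

import Mathlib

namespace AlgNN

noncomputable section

/-- The algebraic sigmoid `φ(x) = x / (1 + x^(2m))^(1/(2m))`. -/
def sigmoid (m : ℕ) (x : ℝ) : ℝ :=
  x / (1 + x ^ (2 * m)) ^ (1 / (2 * (m : ℝ)))

/-- The density `Φ(x) = (φ(x+1) - φ(x-1)) / 4`. -/
def density (m : ℕ) (x : ℝ) : ℝ :=
  (1 / 4) * (sigmoid m (x + 1) - sigmoid m (x - 1))

variable {X : Type*} [NormedAddCommGroup X] [NormedSpace ℝ X]

/-- The neural network operator `A_n(f, x)` on `[a, b]`; it is meant for `⌈na⌉ ≤ ⌊nb⌋`. -/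
def netOp (m : ℕ) (a b : ℝ) (n : ℕ) (f : ℝ → X) (x : ℝ) : X :=
  (∑ k ∈ Finset.Icc ⌈(n : ℝ) * a⌉ ⌊(n : ℝ) * b⌋, density m ((n : ℝ) * x - (k : ℝ)))⁻¹ •
    ∑ k ∈ Finset.Icc ⌈(n : ℝ) * a⌉ ⌊(n : ℝ) * b⌋,
      density m ((n : ℝ) * x - (k : ℝ)) • f ((k : ℝ) / (n : ℝ))

/-- Left Caputo-Bochner derivative `(D_{*x₀}^α f)(y)`, for `a ≤ x₀ ≤ y ≤ b` and non-integer
`α > 0`, of a function `f` on `[a, b]`; here `N = ⌈α⌉`. -/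
def leftCaputo (a b α : ℝ) (f : ℝ → X) (x₀ y : ℝ) : X :=
  (1 / Real.Gamma ((⌈α⌉₊ : ℝ) - α)) •
    ∫ t in x₀..y, ((y - t) ^ ((⌈α⌉₊ : ℝ) - α - 1)) •
      iteratedDerivWithin ⌈α⌉₊ f (Set.Icc a b) t

/-- Right Caputo-Bochner derivative `(D_{x₀-}^α f)(y)`, for `a ≤ y ≤ x₀ ≤ b` and non-integer
`α > 0`, of a function `f` on `[a, b]`; here `N = ⌈α⌉`. -/
def rightCaputo (a b α : ℝ) (f : ℝ → X) (x₀ y : ℝ) : X :=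
  ((-1 : ℝ) ^ ⌈α⌉₊ / Real.Gamma ((⌈α⌉₊ : ℝ) - α)) •
    ∫ z in y..x₀, ((z - y) ^ ((⌈α⌉₊ : ℝ) - α - 1)) •
      iteratedDerivWithin ⌈α⌉₊ f (Set.Icc a b) z

/-- The set of values `‖g y‖`, `y ∈ S`. -/
def normValues (g : ℝ → X) (S : Set ℝ) : Set ℝ :=
  {r | ∃ y ∈ S, r = ‖g y‖}

/-- The supremum norm of `g` over `S`. -/
def supNorm (g : ℝ → X) (S : Set ℝ) : ℝ := sSup (normValues g S)

/-- The set of values `‖g y - g z‖` with `y, z ∈ S` and `|y - z| ≤ δ`. -/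
def oscValues (g : ℝ → X) (δ : ℝ) (S : Set ℝ) : Set ℝ :=
  {r | ∃ y ∈ S, ∃ z ∈ S, |y - z| ≤ δ ∧ r = ‖g y - g z‖}

/-- The first modulus of continuity `ω₁(g, δ)` over `S`. -/
def modulus (g : ℝ → X) (δ : ℝ) (S : Set ℝ) : ℝ := sSup (oscValues g δ S)

end

end AlgNN

open AlgNN

/-! ### Fractional integration and the beta kernel -/

section

open MeasureTheory Set

/-! The error `A_n(f, x) - f(x)` is an average of `f(k/n) - f(x)` with nonnegative weights, so two
ingredients suffice.

Fractional Taylor formula: since the kernel `(y - J)^(α-1) (J - t)^(-α)` has integral `Γ(α)Γ(1-α)`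
over `[t, y]` whatever the endpoints, Fubini recovers `f(y) - f(x) = ∫ f'` as the Riemann–Liouville
integral of order `α` of the Caputo derivative based at `x`. A bound `C` on that derivative between
`x` and `y` thus gives `‖f(y) - f(x)‖ ≤ C |y - x|^α / Γ(α+1)`. The derivative vanishes at `x`, so
for `|y - x| ≤ n^(-β)` one may take `C` to be a modulus of continuity; otherwise `C` is a sup norm.

Weights: sums of `Φ` telescope, have total at most `1`, and have one-sided tails beyond `T =
n^(1-β)` at most `1/(4m(T-2)^(2m))` (`sum_density_filter_gt_le`, `sum_density_filter_lt_le`). Some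
node lies within `1` of `nx`, which bounds the denominator below (`le_sum_density`).
`norm_netOp_sub_le` combines the two. -/

theorem integral_beta_kernel {α : ℝ} (hα0 : 0 < α) (hα1 : α < 1) {t y : ℝ} (hty : t < y) :
    ∫ J in t..y, (y - J) ^ (α - 1) * (J - t) ^ (-α) = Real.Gamma α * Real.Gamma (1 - α) := by
  have hpos : 0 < y - t := sub_pos.2 hty
  have h1 : ∫ J in t..y, (y - J) ^ (α - 1) * (J - t) ^ (-α)
      = ∫ s in (0 : ℝ)..(y - t), s ^ (-α) * ((y - t) - s) ^ (α - 1) := by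
    rw [← sub_self t, ← intervalIntegral.integral_comp_sub_right]
    congr 1
    funext J
    rw [mul_comm]
    congr 2
    ring
  have h2 := Complex.betaIntegral_scaled ((1 - α : ℝ) : ℂ) (α : ℂ) hpos
  -- The beta parameters sum to `1`, so the scaling factor is `(y - t)^0` and the value is
  -- independent of the interval.
  have h3 : ((1 - α : ℝ) : ℂ) + (α : ℂ) - 1 = 0 := by push_cast; ring
  rw [h3, Complex.cpow_zero, one_mul,
    Complex.betaIntegral_eq_Gamma_mul_div _ _ (by simpa using hα1) (by simpa using hα0)] at h2
  have h4 : ((1 - α : ℝ) : ℂ) + (α : ℂ) = 1 := by push_cast; ring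
  rw [h4, Complex.Gamma_one, div_one, Complex.Gamma_ofReal, Complex.Gamma_ofReal] at h2
  have h5 : ∫ s in (0 : ℝ)..(y - t), ((s ^ (-α) * ((y - t) - s) ^ (α - 1) : ℝ) : ℂ)
      = ∫ s in (0 : ℝ)..(y - t),
        (s : ℂ) ^ (((1 - α : ℝ) : ℂ) - 1) * (((y - t : ℝ) : ℂ) - s) ^ ((α : ℂ) - 1) := by
    refine intervalIntegral.integral_congr fun s hs => ?_
    rw [uIcc_of_le hpos.le] at hs
    have e1 : ((1 - α : ℝ) : ℂ) - 1 = ((-α : ℝ) : ℂ) := by push_cast; ring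
    have e2 : (α : ℂ) - 1 = ((α - 1 : ℝ) : ℂ) := by push_cast; ring
    rw [e1, e2, ← Complex.ofReal_sub, Complex.ofReal_mul, Complex.ofReal_cpow hs.1,
      Complex.ofReal_cpow (sub_nonneg.2 hs.2)]
  rw [← h5, intervalIntegral.integral_ofReal] at h2
  rw [h1, mul_comm]
  exact_mod_cast h2

/-- A non-integrable function has Bochner integral `0`, whereas this integral is positive. -/
theorem intervalIntegrable_beta_kernel {α : ℝ} (hα0 : 0 < α) (hα1 : α < 1) {t y : ℝ}
    (hty : t < y) :
    IntervalIntegrable (fun J => (y - J) ^ (α - 1) * (J - t) ^ (-α)) volume t y := by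
  by_contra h
  have h1 := integral_beta_kernel hα0 hα1 hty
  rw [intervalIntegral.integral_undef h] at h1
  have := mul_pos (Real.Gamma_pos_of_pos hα0) (Real.Gamma_pos_of_pos (sub_pos.2 hα1))
  linarith

theorem intervalIntegrable_sub_rpow {r : ℝ} (hr : -1 < r) (x y : ℝ) :
    IntervalIntegrable (fun J => (y - J) ^ r) volume x y := by
  have := (intervalIntegral.intervalIntegrable_rpow' hr (a := y - x) (b := y - y)).comp_sub_left y
  simpa using this

theorem integral_sub_rpow {r : ℝ} (hr : -1 < r) (x y : ℝ) :
    ∫ J in x..y, (y - J) ^ r = (y - x) ^ (r + 1) / (r + 1) := by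
  rw [intervalIntegral.integral_comp_sub_left (fun s => s ^ r), integral_rpow (Or.inl hr)]
  rw [sub_self, Real.zero_rpow (by linarith), sub_zero]

section FractionalIntegral

variable {X : Type*} [NormedAddCommGroup X] [NormedSpace ℝ X]

/-- The Riemann-Liouville integral of order `α` inverts that of order `1 - α` up to one ordinary
integration. -/
theorem integral_rpow_smul_integral_rpow_smul [CompleteSpace X] {α : ℝ} (hα0 : 0 < α) (hα1 : α < 1)
    {x y : ℝ} (hxy : x ≤ y) {g : ℝ → X} (hg : ContinuousOn g (Icc x y)) :
    ∫ J in x..y, (y - J) ^ (α - 1) • ∫ t in x..J, (J - t) ^ (-α) • g t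
      = (Real.Gamma α * Real.Gamma (1 - α)) • ∫ t in x..y, g t := by
  set c := Real.Gamma α * Real.Gamma (1 - α) with hc
  set μ := volume.restrict (Ioo x y) with hμ
  -- The indicator extends the kernel from the triangle `t < J` to the whole square, where Fubini
  -- applies.
  let K : ℝ → ℝ → ℝ := fun J t => (Ioi t).indicator (fun J => (y - J) ^ (α - 1) * (J - t) ^ (-α)) J
  have hKr : ∀ t ∈ Ioo x y, μ.restrict (Ioi t) = volume.restrict (Ioo t y) := by
    intro t ht
    rw [hμ, Measure.restrict_restrict measurableSet_Ioi]
    congr 1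
    ext s
    simp only [mem_inter_iff, mem_Ioi, mem_Ioo] at *
    constructor
    · rintro ⟨h1, h2, h3⟩; exact ⟨h1, h3⟩
    · rintro ⟨h1, h2⟩; exact ⟨h1, ht.1.trans h1, h2⟩
  have hKint : ∀ t ∈ Ioo x y, Integrable (fun J => K J t) μ := by
    intro t ht
    refine (integrable_indicator_iff measurableSet_Ioi).2 ?_
    rw [IntegrableOn, hKr t ht]
    exact (intervalIntegrable_iff_integrableOn_Ioo_of_le ht.2.le).1
      (intervalIntegrable_beta_kernel hα0 hα1 ht.2)
  have hKeq : ∀ t ∈ Ioo x y, ∫ J, K J t ∂μ = c := by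
    intro t ht
    rw [integral_indicator measurableSet_Ioi, hKr t ht, ← integral_Ioc_eq_integral_Ioo,
      ← intervalIntegral.integral_of_le ht.2.le, integral_beta_kernel hα0 hα1 ht.2]
  have hKnn : ∀ t, ∀ J ∈ Ioo x y, 0 ≤ K J t := by
    intro t J hJ
    refine indicator_apply_nonneg fun h => mul_nonneg (Real.rpow_nonneg ?_ _) (Real.rpow_nonneg ?_ _)
    · linarith [hJ.2]
    · linarith [mem_Ioi.1 h]
  have hKmeas : Measurable (fun p : ℝ × ℝ => K p.1 p.2) := by
    have : (fun p : ℝ × ℝ => K p.1 p.2) = {p : ℝ × ℝ | p.2 < p.1}.indicator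
        (fun p => (y - p.1) ^ (α - 1) * (p.1 - p.2) ^ (-α)) := by
      funext p
      simp only [K, indicator, mem_Ioi, mem_ofPred_eq]
    rw [this]
    exact Measurable.indicator (by fun_prop) (measurableSet_lt measurable_snd measurable_fst)
  have hgμ : IntegrableOn g (Ioo x y) :=
    (hg.integrableOn_compact isCompact_Icc).mono_set Ioo_subset_Icc_self
  have hint : Integrable (Function.uncurry fun J t => K J t • g t) (μ.prod μ) := by
    have hm : AEStronglyMeasurable (Function.uncurry fun J t => K J t • g t) (μ.prod μ) :=
      hKmeas.aestronglyMeasurable.smul hgμ.aestronglyMeasurable.comp_snd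
    refine (integrable_prod_iff' hm).2 ⟨?_, ?_⟩
    · filter_upwards [ae_restrict_mem measurableSet_Ioo] with t ht
      exact (hKint t ht).smul_const (g t)
    -- As `K` is nonnegative, integrating the norm over `J` gives exactly `c * ‖g t‖`.
    · refine (hgμ.norm.const_mul c).congr ?_
      filter_upwards [ae_restrict_mem measurableSet_Ioo] with t ht
      rw [← hKeq t ht, ← integral_mul_const]
      refine integral_congr_ae ?_
      filter_upwards [ae_restrict_mem measurableSet_Ioo] with J hJ
      simp only [Function.uncurry, norm_smul, Real.norm_of_nonneg (hKnn t J hJ)]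
  have hswap := integral_integral_swap hint
  have hL : ∫ J in x..y, (y - J) ^ (α - 1) • ∫ t in x..J, (J - t) ^ (-α) • g t
      = ∫ J, ∫ t, K J t • g t ∂μ ∂μ := by
    rw [intervalIntegral.integral_of_le hxy, integral_Ioc_eq_integral_Ioo]
    refine setIntegral_congr_fun measurableSet_Ioo fun J hJ => ?_
    have e1 : (fun t => K J t • g t)
        = (Iio J).indicator (fun t => (y - J) ^ (α - 1) • ((J - t) ^ (-α) • g t)) := by
      funext t
      by_cases h : t < J
      · simp only [K]
        rw [indicator_of_mem (mem_Ioi.2 h), indicator_of_mem (mem_Iio.2 h), mul_smul]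
      · simp only [K]
        rw [indicator_of_notMem (by simpa using h), indicator_of_notMem (by simpa using h), zero_smul]
    have e2 : μ.restrict (Iio J) = volume.restrict (Ioo x J) := by
      rw [hμ, Measure.restrict_restrict measurableSet_Iio]
      congr 1
      ext s
      simp only [mem_inter_iff, mem_Iio, mem_Ioo] at *
      constructor
      · rintro ⟨h1, h2, h3⟩; exact ⟨h2, h1⟩
      · rintro ⟨h1, h2⟩; exact ⟨h2, h1, h2.trans hJ.2⟩
    rw [e1, integral_indicator measurableSet_Iio, e2, integral_smul,
      intervalIntegral.integral_of_le hJ.1.le, integral_Ioc_eq_integral_Ioo]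
  rw [hL, hswap, intervalIntegral.integral_of_le hxy, integral_Ioc_eq_integral_Ioo, ← integral_smul]
  refine setIntegral_congr_fun measurableSet_Ioo fun t ht => ?_
  rw [integral_smul_const, hKeq t ht]

/-- In the inversion formula the inner integral is at most `C * Γ(1-α)`; the outer kernel integrates
to `(y - x)^α / α`, and `α * Γ(α) = Γ(α+1)`. -/
theorem norm_integral_le_of_fractional_bound [CompleteSpace X] {α : ℝ} (hα0 : 0 < α) (hα1 : α < 1)
    {x y : ℝ} (hxy : x ≤ y) {g : ℝ → X} (hg : ContinuousOn g (Icc x y)) {C : ℝ}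
    (hC : ∀ J ∈ Icc x y, ‖(1 / Real.Gamma (1 - α)) • ∫ t in x..J, (J - t) ^ (-α) • g t‖ ≤ C) :
    ‖∫ t in x..y, g t‖ ≤ C * (y - x) ^ α / Real.Gamma (α + 1) := by
  have hΓ := Real.Gamma_pos_of_pos hα0
  have hΓ' := Real.Gamma_pos_of_pos (sub_pos.2 hα1)
  have key := integral_rpow_smul_integral_rpow_smul hα0 hα1 hxy hg
  have hbd : ‖∫ J in x..y, (y - J) ^ (α - 1) • ∫ t in x..J, (J - t) ^ (-α) • g t‖
      ≤ ∫ J in x..y, (y - J) ^ (α - 1) * (C * Real.Gamma (1 - α)) := by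
    refine intervalIntegral.norm_integral_le_of_norm_le hxy (.of_forall fun J hJ => ?_)
      ((intervalIntegrable_sub_rpow (by linarith) x y).mul_const _)
    have h1 := hC J ⟨hJ.1.le, hJ.2⟩
    rw [norm_smul, Real.norm_of_nonneg (by positivity), one_div, inv_mul_le_iff₀ hΓ'] at h1
    rw [norm_smul, Real.norm_of_nonneg (Real.rpow_nonneg (sub_nonneg.2 hJ.2) _), mul_comm C]
    exact mul_le_mul_of_nonneg_left h1 (Real.rpow_nonneg (sub_nonneg.2 hJ.2) _)
  rw [key, norm_smul, Real.norm_of_nonneg (by positivity), intervalIntegral.integral_mul_const,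
    integral_sub_rpow (by linarith), sub_add_cancel] at hbd
  rw [Real.Gamma_add_one hα0.ne', le_div_iff₀ (by positivity)]
  refine le_of_mul_le_mul_right ?_ hΓ'
  calc ‖∫ t in x..y, g t‖ * (α * Real.Gamma α) * Real.Gamma (1 - α)
      = α * (Real.Gamma α * Real.Gamma (1 - α) * ‖∫ t in x..y, g t‖) := by ring
    _ ≤ α * ((y - x) ^ α / α * (C * Real.Gamma (1 - α))) :=
        mul_le_mul_of_nonneg_left hbd hα0.le
    _ = C * (y - x) ^ α * Real.Gamma (1 - α) := by field_simp

theorem norm_integral_le_of_fractional_bound_right [CompleteSpace X] {α : ℝ} (hα0 : 0 < α)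
    (hα1 : α < 1) {x y : ℝ} (hyx : y ≤ x) {g : ℝ → X} (hg : ContinuousOn g (Icc y x)) {C : ℝ}
    (hC : ∀ J ∈ Icc y x, ‖(1 / Real.Gamma (1 - α)) • ∫ z in J..x, (z - J) ^ (-α) • g z‖ ≤ C) :
    ‖∫ t in y..x, g t‖ ≤ C * (x - y) ^ α / Real.Gamma (α + 1) := by
  -- Reflection `t ↦ -t` turns the right-sided case into the left-sided one.
  have hg' : ContinuousOn (fun t => g (-t)) (Icc (-x) (-y)) :=
    hg.comp continuous_neg.continuousOn fun t ht => ⟨by linarith [ht.2], by linarith [ht.1]⟩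
  have h := norm_integral_le_of_fractional_bound hα0 hα1 (neg_le_neg hyx) hg' (C := C) ?_
  · rw [intervalIntegral.integral_comp_neg (fun t => g t), neg_neg, neg_neg] at h
    convert h using 4
    ring
  · intro J hJ
    have h1 := hC (-J) ⟨by linarith [hJ.2], by linarith [hJ.1]⟩
    have h2 := intervalIntegral.integral_comp_neg (a := -x) (b := J)
      (fun z => (z - -J) ^ (-α) • g z)
    rw [neg_neg] at h2
    rw [← h2] at h1
    convert h1 using 7
    ring

end FractionalIntegral

/-! ### The sigmoid and sums of its density -/

theorem one_le_one_add_pow_two_mul (m : ℕ) (x : ℝ) : 1 ≤ 1 + x ^ (2 * m) := by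
  have := (even_two_mul m).pow_nonneg x
  linarith

theorem one_add_pow_rpow_pos (m : ℕ) (x r : ℝ) : 0 < (1 + x ^ (2 * m)) ^ r :=
  Real.rpow_pos_of_pos (by linarith [one_le_one_add_pow_two_mul m x]) r

theorem pow_two_mul_rpow {m : ℕ} (hm : 1 ≤ m) {x : ℝ} (hx : 0 ≤ x) :
    (x ^ (2 * m)) ^ (1 / (2 * (m : ℝ))) = x := by
  have := Real.pow_rpow_inv_natCast hx (n := 2 * m) (by omega)
  rw [one_div]
  exact_mod_cast this

theorem sigmoid_neg (m : ℕ) (x : ℝ) : sigmoid m (-x) = -sigmoid m x := by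
  rw [sigmoid, sigmoid, (even_two_mul m).neg_pow, neg_div]

theorem sigmoid_nonneg (m : ℕ) {x : ℝ} (hx : 0 ≤ x) : 0 ≤ sigmoid m x :=
  div_nonneg hx (one_add_pow_rpow_pos m x _).le

theorem sigmoid_le_one {m : ℕ} (hm : 1 ≤ m) (x : ℝ) : sigmoid m x ≤ 1 := by
  rw [sigmoid, div_le_one (one_add_pow_rpow_pos m x _)]
  rcases le_total x 0 with hx | hx
  · exact hx.trans (one_add_pow_rpow_pos m x _).le
  · conv_lhs => rw [← pow_two_mul_rpow hm hx]
    exact Real.rpow_le_rpow (by positivity) (by linarith) (by positivity)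

theorem neg_one_le_sigmoid {m : ℕ} (hm : 1 ≤ m) (x : ℝ) : -1 ≤ sigmoid m x := by
  have := sigmoid_le_one hm (-x)
  rw [sigmoid_neg] at this
  linarith

theorem sigmoid_monotone {m : ℕ} (hm : 1 ≤ m) : Monotone (sigmoid m) := by
  have hpos : ∀ x y : ℝ, 0 ≤ x → x ≤ y → sigmoid m x ≤ sigmoid m y := by
    intro x y hx hxy
    have hy := hx.trans hxy
    rw [sigmoid, sigmoid, div_le_div_iff₀ (one_add_pow_rpow_pos m x _) (one_add_pow_rpow_pos m y _)]
    -- Writing each numerator as a `2m`-th root reduces the claim to `x^(2m) (1 + y^(2m)) ≤ y^(2m)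
    -- (1 + x^(2m))`.
    conv_lhs => enter [1]; rw [← pow_two_mul_rpow hm hx]
    conv_rhs => enter [1]; rw [← pow_two_mul_rpow hm hy]
    rw [← Real.mul_rpow (by positivity) (by positivity),
      ← Real.mul_rpow (by positivity) (by positivity)]
    refine Real.rpow_le_rpow (by positivity) ?_ (by positivity)
    have := pow_le_pow_left₀ hx hxy (2 * m)
    nlinarith
  intro x y hxy
  rcases le_total 0 x with hx | hx
  · exact hpos x y hx hxy
  rcases le_total 0 y with hy | hy
  · have h1 := sigmoid_nonneg m (neg_nonneg.2 hx)
    have h2 := sigmoid_nonneg m hy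
    rw [sigmoid_neg] at h1
    linarith
  · have := hpos (-y) (-x) (neg_nonneg.2 hy) (neg_le_neg hxy)
    rw [sigmoid_neg, sigmoid_neg] at this
    linarith

/-- Split the numerator `p + q`; the denominator at `p + q` dominates those at `p` and `q`. -/
theorem sigmoid_add_le (m : ℕ) {p q : ℝ} (hp : 0 ≤ p) (hq : 0 ≤ q) :
    sigmoid m (p + q) ≤ sigmoid m p + sigmoid m q := by
  have key : ∀ u : ℝ, 0 ≤ u → u ≤ p + q →
      u / (1 + (p + q) ^ (2 * m)) ^ (1 / (2 * (m : ℝ))) ≤ sigmoid m u := by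
    intro u hu hle
    refine div_le_div_of_nonneg_left hu (one_add_pow_rpow_pos m u _) ?_
    refine Real.rpow_le_rpow (by linarith [one_le_one_add_pow_two_mul m u]) ?_ (by positivity)
    have := pow_le_pow_left₀ hu hle (2 * m)
    linarith
  rw [sigmoid, add_div]
  exact add_le_add (key p hp (by linarith)) (key q hq (by linarith))

theorem density_nonneg {m : ℕ} (hm : 1 ≤ m) (x : ℝ) : 0 ≤ density m x := by
  have := sigmoid_monotone hm (show x - 1 ≤ x + 1 by linarith)
  rw [density]
  linarith

/-- By oddness `4Φ(y) = φ(1+y) + φ(1-y)`, which is at least `φ(2)` by subadditivity. -/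
theorem le_density_of_abs_le_one (m : ℕ) {y : ℝ} (hy : |y| ≤ 1) :
    (2 * (1 + (4 : ℝ) ^ m) ^ (1 / (2 * (m : ℝ))))⁻¹ ≤ density m y := by
  obtain ⟨h1, h2⟩ := abs_le.1 hy
  have h := sigmoid_add_le m (p := 1 + y) (q := 1 - y) (by linarith) (by linarith)
  have e : sigmoid m (1 + y + (1 - y)) = 2 / (1 + (4 : ℝ) ^ m) ^ (1 / (2 * (m : ℝ))) := by
    rw [sigmoid, show 1 + y + (1 - y) = 2 by ring, pow_mul]
    norm_num
  have e2 : sigmoid m (y - 1) = -sigmoid m (1 - y) := by rw [← sigmoid_neg]; congr 1; ring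
  rw [e] at h
  rw [density, e2, add_comm y 1]
  calc (2 * (1 + (4 : ℝ) ^ m) ^ (1 / (2 * (m : ℝ))))⁻¹
      = 1 / 4 * (2 / (1 + (4 : ℝ) ^ m) ^ (1 / (2 * (m : ℝ)))) := by
        rw [mul_inv]; ring
    _ ≤ _ := by linarith

theorem one_sub_sigmoid_le {m : ℕ} (hm : 1 ≤ m) {s : ℝ} (hs : 0 < s) :
    1 - sigmoid m s ≤ 1 / (2 * m * s ^ (2 * m)) := by
  have hm' : (1 : ℝ) ≤ m := by exact_mod_cast hm
  set u : ℝ := 1 / (2 * m * s ^ (2 * m)) with hu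
  have hu0 : 0 < u := by positivity
  have h1 : (1 + s ^ (2 * m)) ^ (1 / (2 * (m : ℝ))) ≤ s * (1 + u) := by
    -- After factoring out `s^(2m)`, Bernoulli's inequality with exponent `1/(2m) ≤ 1` bounds the
    -- root by `s(1 + u)`.
    have e : 1 + s ^ (2 * m) = s ^ (2 * m) * (1 + (s ^ (2 * m))⁻¹) := by field_simp; ring
    rw [e, Real.mul_rpow (by positivity) (by positivity), pow_two_mul_rpow hm hs.le]
    refine mul_le_mul_of_nonneg_left ?_ hs.le
    refine (rpow_one_add_le_one_add_mul_self
      (by linarith [inv_pos.2 (pow_pos hs (2 * m))]) (by positivity) ?_).trans_eq ?_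
    · rw [div_le_one (by positivity)]; linarith
    · rw [hu]; field_simp
  have h2 : 1 / (1 + u) ≤ sigmoid m s := by
    rw [sigmoid, div_le_div_iff₀ (by positivity) (one_add_pow_rpow_pos m s _)]
    linarith
  have h3 : 1 - u ≤ 1 / (1 + u) := by
    rw [le_div_iff₀ (by positivity)]; nlinarith
  linarith

/-- `Φ` is a difference over step `2`, so telescoping leaves two sigmoid values at each end. -/
theorem sum_Ico_density (m : ℕ) (z : ℝ) {p q : ℤ} (hpq : p ≤ q) :
    ∑ k ∈ Finset.Ico p q, density m (z - k)
      = (1 / 4) * ((sigmoid m (z - p + 1) + sigmoid m (z - p))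
        - (sigmoid m (z - q + 1) + sigmoid m (z - q))) := by
  induction q, hpq using Int.leInduction with
  | base => simp
  | succ q hpq ih =>
    have : Finset.Ico p (q + 1) = insert q (Finset.Ico p q) := by
      ext k; simp only [Finset.mem_Ico, Finset.mem_insert]; omega
    rw [this, Finset.sum_insert (by simp), ih, density]
    push_cast
    rw [show z - (q + 1 : ℝ) + 1 = z - q by ring, show z - (q + 1 : ℝ) = z - q - 1 by ring]
    ring

theorem sum_density_le_one {m : ℕ} (hm : 1 ≤ m) (z : ℝ) (p q : ℤ) :
    ∑ k ∈ Finset.Icc p q, density m (z - k) ≤ 1 := by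
  rcases le_or_gt p (q + 1) with h | h
  · have e : Finset.Icc p q = Finset.Ico p (q + 1) := by
      ext k; simp only [Finset.mem_Ico, Finset.mem_Icc]; omega
    rw [e, sum_Ico_density m z h]
    linarith [sigmoid_le_one hm (z - p + 1), sigmoid_le_one hm (z - p),
      neg_one_le_sigmoid hm (z - (q + 1 : ℤ) + 1), neg_one_le_sigmoid hm (z - (q + 1 : ℤ))]
  · rw [Finset.Icc_eq_empty (by omega)]; simp

theorem half_one_sub_sigmoid_le {m : ℕ} (hm : 1 ≤ m) {T : ℝ} (hT : 2 < T) :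
    (1 / 2) * (1 - sigmoid m (T - 1)) ≤ 1 / (4 * m * (T - 2) ^ (2 * m)) := by
  have hm' : (1 : ℝ) ≤ m := by exact_mod_cast hm
  have h0 : 0 < T - 2 := by linarith
  have h1 := one_sub_sigmoid_le hm (show 0 < T - 1 by linarith)
  calc (1 / 2) * (1 - sigmoid m (T - 1)) ≤ (1 / 2) * (1 / (2 * m * (T - 1) ^ (2 * m))) := by linarith
    _ = 1 / (4 * m * (T - 1) ^ (2 * m)) := by
      have : 0 < T - 1 := by linarith
      field_simp; norm_num
    -- The tails give `T - 1`; it is weakened to the `T - 2` of the final bound.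
    _ ≤ 1 / (4 * m * (T - 2) ^ (2 * m)) := by
      refine one_div_le_one_div_of_le (by positivity) (mul_le_mul_of_nonneg_left ?_ (by positivity))
      exact pow_le_pow_left₀ h0.le (by linarith) _

theorem sum_density_filter_gt_le {m : ℕ} (hm : 1 ≤ m) (z : ℝ) {T : ℝ} (hT : 2 < T) (p q : ℤ) :
    ∑ k ∈ (Finset.Icc p q).filter (fun k : ℤ => z + T < k), density m (z - k)
      ≤ 1 / (4 * m * (T - 2) ^ (2 * m)) := by
  refine le_trans ?_ (half_one_sub_sigmoid_le hm hT)
  set r : ℤ := ⌊z + T⌋ + 1 with hr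
  have hsub : (Finset.Icc p q).filter (fun k : ℤ => z + T < k) ⊆ Finset.Ico r (q + 1) := by
    intro k hk
    simp only [Finset.mem_filter, Finset.mem_Icc, Finset.mem_Ico] at hk ⊢
    have := Int.floor_lt.2 hk.2
    omega
  refine (Finset.sum_le_sum_of_subset_of_nonneg hsub fun k _ _ => density_nonneg hm _).trans ?_
  rcases le_or_gt r (q + 1) with h | h
  · rw [sum_Ico_density m z h]
    have hlt : z + T < r := by rw [hr]; push_cast; exact Int.lt_floor_add_one _
    -- The shift `+ 1` in the telescoped end values is what turns `T` into `T - 1`.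
    have h1 := sigmoid_monotone hm (show z - r + 1 ≤ -(T - 1) by linarith)
    have h2 := sigmoid_monotone hm (show z - r ≤ -(T - 1) by linarith)
    rw [sigmoid_neg] at h1 h2
    linarith [neg_one_le_sigmoid hm (z - (q + 1 : ℤ) + 1), neg_one_le_sigmoid hm (z - (q + 1 : ℤ))]
  · rw [Finset.Ico_eq_empty (by omega)]
    have := sigmoid_le_one hm (T - 1)
    simp only [Finset.sum_empty]; linarith

theorem sum_density_filter_lt_le {m : ℕ} (hm : 1 ≤ m) (z : ℝ) {T : ℝ} (hT : 2 < T) (p q : ℤ) :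
    ∑ k ∈ (Finset.Icc p q).filter (fun k : ℤ => (k : ℝ) < z - T), density m (z - k)
      ≤ 1 / (4 * m * (T - 2) ^ (2 * m)) := by
  refine le_trans ?_ (half_one_sub_sigmoid_le hm hT)
  set r : ℤ := ⌈z - T⌉ with hr
  have hsub : (Finset.Icc p q).filter (fun k : ℤ => (k : ℝ) < z - T) ⊆ Finset.Ico p r := by
    intro k hk
    simp only [Finset.mem_filter, Finset.mem_Icc, Finset.mem_Ico] at hk ⊢
    exact ⟨hk.1.1, Int.lt_ceil.2 hk.2⟩
  refine (Finset.sum_le_sum_of_subset_of_nonneg hsub fun k _ _ => density_nonneg hm _).trans ?_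
  rcases le_or_gt p r with h | h
  · rw [sum_Ico_density m z h]
    -- On this side, rounding up to `r` costs the unit.
    have hlt : (r : ℝ) < z - T + 1 := Int.ceil_lt_add_one _
    have h1 := sigmoid_monotone hm (show T - 1 ≤ z - r + 1 by linarith)
    have h2 := sigmoid_monotone hm (show T - 1 ≤ z - r by linarith)
    linarith [sigmoid_le_one hm (z - p + 1), sigmoid_le_one hm (z - p)]
  · rw [Finset.Ico_eq_empty (by omega)]
    have := sigmoid_le_one hm (T - 1)
    simp only [Finset.sum_empty]; linarith

theorem le_sum_density {m : ℕ} (hm : 1 ≤ m) {u v z : ℝ} (hz : z ∈ Icc u v) (huv : ⌈u⌉ ≤ ⌊v⌋) :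
    (2 * (1 + (4 : ℝ) ^ m) ^ (1 / (2 * (m : ℝ))))⁻¹
      ≤ ∑ k ∈ Finset.Icc ⌈u⌉ ⌊v⌋, density m (z - k) := by
  obtain ⟨k, hk, hzk⟩ : ∃ k ∈ Finset.Icc ⌈u⌉ ⌊v⌋, |z - (k : ℝ)| ≤ 1 := by
    -- The nearby node is `⌊z⌋`, unless `z` precedes the first node `⌈u⌉`.
    rcases le_or_gt (⌈u⌉ : ℝ) z with h | h
    · refine ⟨⌊z⌋, Finset.mem_Icc.2 ⟨Int.le_floor.2 h, Int.floor_le_floor hz.2⟩, ?_⟩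
      rw [abs_le]
      constructor <;> linarith [Int.floor_le z, Int.lt_floor_add_one z]
    · refine ⟨⌈u⌉, Finset.mem_Icc.2 ⟨le_rfl, huv⟩, ?_⟩
      rw [abs_le]
      constructor <;> linarith [Int.ceil_lt_add_one u, hz.1]
  exact (le_density_of_abs_le_one m hzk).trans
    (Finset.single_le_sum (f := fun k : ℤ => density m (z - k))
      (fun k _ => density_nonneg hm _) hk)

/-! ### Suprema, with boundedness supplied because real `sSup` of an unbounded set is `0` -/

section Suprema

variable {X : Type*} [NormedAddCommGroup X] {g : ℝ → X} {S : Set ℝ} {B δ : ℝ}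

theorem bddAbove_normValues (hB : ∀ y ∈ S, ‖g y‖ ≤ B) : BddAbove (normValues g S) :=
  ⟨B, by rintro r ⟨y, hy, rfl⟩; exact hB y hy⟩

theorem bddAbove_oscValues (hB : ∀ y ∈ S, ‖g y‖ ≤ B) : BddAbove (oscValues g δ S) :=
  ⟨B + B, by
    rintro r ⟨y, hy, z, hz, -, rfl⟩
    exact (norm_sub_le _ _).trans (add_le_add (hB y hy) (hB z hz))⟩

theorem supNorm_le (hS : S.Nonempty) (hB : ∀ y ∈ S, ‖g y‖ ≤ B) : supNorm g S ≤ B :=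
  csSup_le (let ⟨y, hy⟩ := hS; ⟨‖g y‖, y, hy, rfl⟩) (by rintro r ⟨y, hy, rfl⟩; exact hB y hy)

theorem supNorm_nonneg : 0 ≤ supNorm g S :=
  Real.sSup_nonneg (by rintro r ⟨y, -, rfl⟩; exact norm_nonneg _)

theorem modulus_nonneg : 0 ≤ modulus g δ S :=
  Real.sSup_nonneg (by rintro r ⟨y, -, z, -, -, rfl⟩; exact norm_nonneg _)

theorem modulus_le (hB : ∀ y ∈ S, ‖g y‖ ≤ B) (hB0 : 0 ≤ B) : modulus g δ S ≤ B + B :=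
  Real.sSup_le (by
    rintro r ⟨y, hy, z, hz, -, rfl⟩
    exact (norm_sub_le _ _).trans (add_le_add (hB y hy) (hB z hz))) (by linarith)

theorem norm_le_supNorm (hB : ∀ y ∈ S, ‖g y‖ ≤ B) {y : ℝ} (hy : y ∈ S) : ‖g y‖ ≤ supNorm g S :=
  le_csSup (bddAbove_normValues hB) ⟨y, hy, rfl⟩

theorem norm_sub_le_modulus (hB : ∀ y ∈ S, ‖g y‖ ≤ B) {y z : ℝ} (hy : y ∈ S) (hz : z ∈ S)
    (hyz : |y - z| ≤ δ) : ‖g y - g z‖ ≤ modulus g δ S :=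
  le_csSup (bddAbove_oscValues hB) ⟨y, hy, z, hz, hyz, rfl⟩

end Suprema

section Approximation

variable {X : Type*} [NormedAddCommGroup X] [NormedSpace ℝ X]

/-! ### Caputo derivatives and increments of `f` -/

section Caputo

variable {a b α : ℝ} {f : ℝ → X}

theorem natCeil_eq_one (hα0 : 0 < α) (hα1 : α < 1) : ⌈α⌉₊ = 1 := by
  rw [Nat.ceil_eq_iff one_ne_zero]
  simpa using ⟨hα0, hα1.le⟩

theorem leftCaputo_eq (hα0 : 0 < α) (hα1 : α < 1) (x y : ℝ) :
    leftCaputo a b α f x y = (1 / Real.Gamma (1 - α)) •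
      ∫ t in x..y, (y - t) ^ (-α) • derivWithin f (Icc a b) t := by
  rw [leftCaputo, natCeil_eq_one hα0 hα1, Nat.cast_one, show (1 : ℝ) - α - 1 = -α by ring,
    iteratedDerivWithin_one]

theorem rightCaputo_eq (hα0 : 0 < α) (hα1 : α < 1) (x y : ℝ) :
    rightCaputo a b α f x y = -((1 / Real.Gamma (1 - α)) •
      ∫ z in y..x, (z - y) ^ (-α) • derivWithin f (Icc a b) z) := by
  rw [rightCaputo, natCeil_eq_one hα0 hα1, Nat.cast_one, show (1 : ℝ) - α - 1 = -α by ring,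
    iteratedDerivWithin_one, pow_one, neg_div, neg_smul]

/-- Vanishing at the base point is what lets a modulus of continuity bound the derivative itself
near `x`. -/
theorem leftCaputo_self (x : ℝ) : leftCaputo a b α f x x = 0 := by
  simp [leftCaputo]

theorem rightCaputo_self (x : ℝ) : rightCaputo a b α f x x = 0 := by
  simp [rightCaputo]

theorem norm_smul_integral_rpow_smul_le {M : ℝ} (hα1 : α < 1)
    {g : ℝ → X} (hM : ∀ t ∈ Icc a b, ‖g t‖ ≤ M) {x y : ℝ} (hx : a ≤ x) (hxy : x ≤ y)
    (hy : y ≤ b) :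
    ‖(1 / Real.Gamma (1 - α)) • ∫ t in x..y, (y - t) ^ (-α) • g t‖
      ≤ 1 / Real.Gamma (1 - α) * ((b - a) ^ (1 - α) / (1 - α) * M) := by
  have hΓ := Real.Gamma_pos_of_pos (sub_pos.2 hα1)
  have h1 : 0 < 1 - α := sub_pos.2 hα1
  have hM0 : 0 ≤ M := (norm_nonneg _).trans (hM x ⟨hx, hxy.trans hy⟩)
  rw [norm_smul, Real.norm_of_nonneg (by positivity)]
  refine mul_le_mul_of_nonneg_left ?_ (by positivity)
  calc ‖∫ t in x..y, (y - t) ^ (-α) • g t‖ ≤ ∫ t in x..y, (y - t) ^ (-α) * M := by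
        refine intervalIntegral.norm_integral_le_of_norm_le hxy (.of_forall fun t ht => ?_)
          ((intervalIntegrable_sub_rpow (by linarith) x y).mul_const _)
        have h2 := Real.rpow_nonneg (sub_nonneg.2 ht.2) (-α)
        rw [norm_smul, Real.norm_of_nonneg h2]
        exact mul_le_mul_of_nonneg_left (hM t ⟨hx.trans ht.1.le, ht.2.trans hy⟩) h2
    _ = (y - x) ^ (1 - α) / (1 - α) * M := by
        rw [intervalIntegral.integral_mul_const, integral_sub_rpow (by linarith),
          show -α + 1 = 1 - α by ring]
    _ ≤ _ := by
        have := Real.rpow_le_rpow (sub_nonneg.2 hxy) (show y - x ≤ b - a by linarith) h1.le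
        gcongr

/-- `f'` is bounded by compactness and the weakly singular kernel has bounded integral. One `B`
serves all base points, as the suprema over `x` require. -/
theorem exists_bound_caputo (hα0 : 0 < α) (hα1 : α < 1) (hab : a < b)
    (hf : ContDiffOn ℝ 1 f (Icc a b)) :
    ∃ B : ℝ, 0 ≤ B ∧ ∀ x ∈ Icc a b, (∀ y ∈ Icc a x, ‖rightCaputo a b α f x y‖ ≤ B) ∧
      ∀ y ∈ Icc x b, ‖leftCaputo a b α f x y‖ ≤ B := by
  have hd : ContinuousOn (derivWithin f (Icc a b)) (Icc a b) :=
    hf.continuousOn_derivWithin (uniqueDiffOn_Icc hab) le_rfl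
  obtain ⟨M, hM⟩ := isCompact_Icc.exists_bound_of_continuousOn hd
  have hM0 : 0 ≤ M := (norm_nonneg _).trans (hM a ⟨le_rfl, hab.le⟩)
  have hΓ := Real.Gamma_pos_of_pos (sub_pos.2 hα1)
  have h1 : 0 < 1 - α := sub_pos.2 hα1
  have h2 : 0 < b - a := sub_pos.2 hab
  refine ⟨1 / Real.Gamma (1 - α) * ((b - a) ^ (1 - α) / (1 - α) * M), by positivity,
    fun x hx => ⟨fun y hy => ?_, fun y hy => ?_⟩⟩
  · have h3 := norm_smul_integral_rpow_smul_le (a := -b) (b := -a) hα1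
      (g := fun t => derivWithin f (Icc a b) (-t)) (M := M)
      (fun t ht => hM _ ⟨by linarith [ht.2], by linarith [ht.1]⟩) (neg_le_neg hx.2)
      (neg_le_neg hy.2) (neg_le_neg hy.1)
    have h4 : ∫ t in -x..-y, (-y - t) ^ (-α) • derivWithin f (Icc a b) (-t)
        = ∫ z in y..x, (z - y) ^ (-α) • derivWithin f (Icc a b) z := by
      have h5 := intervalIntegral.integral_comp_neg (a := -x) (b := -y)
        (fun z => (z - y) ^ (-α) • derivWithin f (Icc a b) z)
      rw [neg_neg, neg_neg] at h5
      rw [← h5]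
      congr 1
      funext t
      rw [show -y - t = -t - y by ring]
    rw [h4, show -a - -b = b - a by ring] at h3
    rwa [rightCaputo_eq hα0 hα1, norm_neg]
  · rw [leftCaputo_eq hα0 hα1]
    exact norm_smul_integral_rpow_smul_le hα1 hM hx.1 hy.1 hy.2

theorem integral_derivWithin_Icc [CompleteSpace X] (hab : a < b)
    (hf : ContDiffOn ℝ 1 f (Icc a b)) {x y : ℝ} (hx : a ≤ x) (hxy : x ≤ y) (hy : y ≤ b) :
    ∫ t in x..y, derivWithin f (Icc a b) t = f y - f x := by
  have hd : ContinuousOn (derivWithin f (Icc a b)) (Icc a b) :=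
    hf.continuousOn_derivWithin (uniqueDiffOn_Icc hab) le_rfl
  have hsub : Icc x y ⊆ Icc a b := Icc_subset_Icc hx hy
  refine intervalIntegral.integral_eq_sub_of_hasDerivAt_of_le hxy (hf.continuousOn.mono hsub) ?_
    ((hd.mono hsub).intervalIntegrable_of_Icc hxy)
  intro t ht
  have htm : t ∈ Icc a b := hsub (Ioo_subset_Icc_self ht)
  exact ((hf.differentiableOn one_ne_zero) t htm).hasDerivWithinAt.hasDerivAt
    (Icc_mem_nhds (hx.trans_lt ht.1) (ht.2.trans_le hy))

theorem norm_sub_le_of_leftCaputo_le [CompleteSpace X] (hα0 : 0 < α) (hα1 : α < 1) (hab : a < b)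
    (hf : ContDiffOn ℝ 1 f (Icc a b)) {x y C : ℝ} (hx : a ≤ x) (hxy : x ≤ y) (hy : y ≤ b)
    (hC : ∀ J ∈ Icc x y, ‖leftCaputo a b α f x J‖ ≤ C) :
    ‖f y - f x‖ ≤ C * (y - x) ^ α / Real.Gamma (α + 1) := by
  have hd : ContinuousOn (derivWithin f (Icc a b)) (Icc a b) :=
    hf.continuousOn_derivWithin (uniqueDiffOn_Icc hab) le_rfl
  rw [← integral_derivWithin_Icc hab hf hx hxy hy]
  refine norm_integral_le_of_fractional_bound hα0 hα1 hxy (hd.mono (Icc_subset_Icc hx hy)) ?_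
  intro J hJ
  rw [← leftCaputo_eq hα0 hα1]
  exact hC J hJ

theorem norm_sub_le_of_rightCaputo_le [CompleteSpace X] (hα0 : 0 < α) (hα1 : α < 1) (hab : a < b)
    (hf : ContDiffOn ℝ 1 f (Icc a b)) {x y C : ℝ} (hy : a ≤ y) (hyx : y ≤ x) (hx : x ≤ b)
    (hC : ∀ J ∈ Icc y x, ‖rightCaputo a b α f x J‖ ≤ C) :
    ‖f y - f x‖ ≤ C * (x - y) ^ α / Real.Gamma (α + 1) := by
  have hd : ContinuousOn (derivWithin f (Icc a b)) (Icc a b) :=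
    hf.continuousOn_derivWithin (uniqueDiffOn_Icc hab) le_rfl
  rw [norm_sub_rev, ← integral_derivWithin_Icc hab hf hy hyx hx]
  refine norm_integral_le_of_fractional_bound_right hα0 hα1 hyx
    (hd.mono (Icc_subset_Icc hy hx)) ?_
  intro J hJ
  rw [← norm_neg, ← rightCaputo_eq hα0 hα1]
  exact hC J hJ

end Caputo

/-! ### Averaging with the density weights -/

section Network

variable {a b : ℝ} {m n : ℕ} {f : ℝ → X}

/-- A bound on the error of the network operator from a bound on `f (k / n) - f x` that
distinguishes nodes near `x`, far to the left of `x` and far to the right of `x`. -/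
theorem norm_netOp_sub_le (hm : 1 ≤ m) (hnab : ⌈(n : ℝ) * a⌉ ≤ ⌊(n : ℝ) * b⌋) {x : ℝ}
    (hx : x ∈ Icc a b) {T E₀ E₁ E₂ : ℝ} (hT : 2 < T) (hE₀ : 0 ≤ E₀) (hE₁ : 0 ≤ E₁) (hE₂ : 0 ≤ E₂)
    (hnear : ∀ k ∈ Finset.Icc ⌈(n : ℝ) * a⌉ ⌊(n : ℝ) * b⌋, |(k : ℝ) - n * x| ≤ T →
      ‖f ((k : ℝ) / n) - f x‖ ≤ E₀)
    (hleft : ∀ k ∈ Finset.Icc ⌈(n : ℝ) * a⌉ ⌊(n : ℝ) * b⌋, (k : ℝ) < n * x - T →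
      ‖f ((k : ℝ) / n) - f x‖ ≤ E₁)
    (hright : ∀ k ∈ Finset.Icc ⌈(n : ℝ) * a⌉ ⌊(n : ℝ) * b⌋, n * x + T < (k : ℝ) →
      ‖f ((k : ℝ) / n) - f x‖ ≤ E₂) :
    ‖netOp m a b n f x - f x‖ ≤ 2 * (1 + (4 : ℝ) ^ m) ^ (1 / (2 * (m : ℝ))) *
      (E₀ + 1 / (4 * m * (T - 2) ^ (2 * m)) * (E₁ + E₂)) := by
  have hn0 : (0 : ℝ) ≤ n := Nat.cast_nonneg n
  have hV := le_sum_density hm (z := n * x) ⟨mul_le_mul_of_nonneg_left hx.1 hn0,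
    mul_le_mul_of_nonneg_left hx.2 hn0⟩ hnab
  have hc : 0 < 2 * (1 + (4 : ℝ) ^ m) ^ (1 / (2 * (m : ℝ))) := by positivity
  have hVone := sum_density_le_one hm (n * x) ⌈(n : ℝ) * a⌉ ⌊(n : ℝ) * b⌋
  have hl := sum_density_filter_lt_le hm (n * x) hT ⌈(n : ℝ) * a⌉ ⌊(n : ℝ) * b⌋
  have hr := sum_density_filter_gt_le hm (n * x) hT ⌈(n : ℝ) * a⌉ ⌊(n : ℝ) * b⌋
  unfold netOp
  set I := Finset.Icc ⌈(n : ℝ) * a⌉ ⌊(n : ℝ) * b⌋ with hI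
  set V := ∑ k ∈ I, density m ((n : ℝ) * x - (k : ℝ)) with hVdef
  set τ := 1 / (4 * (m : ℝ) * (T - 2) ^ (2 * m)) with hτ
  have hV0 : 0 < V := (inv_pos.2 hc).trans_le hV
  have e : V⁻¹ • ∑ k ∈ I, density m ((n : ℝ) * x - k) • f ((k : ℝ) / n) - f x
      = V⁻¹ • ∑ k ∈ I, density m ((n : ℝ) * x - k) • (f ((k : ℝ) / n) - f x) := by
    simp_rw [smul_sub]
    rw [Finset.sum_sub_distrib, ← Finset.sum_smul, smul_sub, inv_smul_smul₀ hV0.ne']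
  rw [e, norm_smul, Real.norm_of_nonneg (inv_nonneg.2 hV0.le)]
  -- `E₀` is charged to every node, since the total mass is at most `1`; only `E₁` and `E₂` are
  -- confined to the tails.
  have hterm : ∀ k ∈ I, ‖density m ((n : ℝ) * x - k) • (f ((k : ℝ) / n) - f x)‖
      ≤ density m ((n : ℝ) * x - k) * E₀
        + (if (k : ℝ) < n * x - T then density m ((n : ℝ) * x - k) else 0) * E₁
        + (if n * x + T < (k : ℝ) then density m ((n : ℝ) * x - k) else 0) * E₂ := by
    intro k hk
    have hd := density_nonneg hm ((n : ℝ) * x - k)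
    have p₀ := mul_nonneg hd hE₀
    have p₁ := mul_nonneg hd hE₁
    have p₂ := mul_nonneg hd hE₂
    rw [norm_smul, Real.norm_of_nonneg hd]
    by_cases h₁ : (k : ℝ) < n * x - T
    · have := mul_le_mul_of_nonneg_left (hleft k hk h₁) hd
      rw [if_pos h₁, if_neg (by linarith)]
      linarith
    · by_cases h₂ : n * x + T < (k : ℝ)
      · have := mul_le_mul_of_nonneg_left (hright k hk h₂) hd
        rw [if_pos h₂, if_neg h₁]
        linarith
      · have := mul_le_mul_of_nonneg_left
          (hnear k hk (abs_le.2 ⟨by linarith, by linarith⟩)) hd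
        rw [if_neg h₁, if_neg h₂]
        linarith
  have hsum : ‖∑ k ∈ I, density m ((n : ℝ) * x - k) • (f ((k : ℝ) / n) - f x)‖
      ≤ E₀ + τ * (E₁ + E₂) := by
    refine (norm_sum_le _ _).trans ((Finset.sum_le_sum hterm).trans ?_)
    rw [Finset.sum_add_distrib, Finset.sum_add_distrib, ← Finset.sum_mul, ← Finset.sum_mul,
      ← Finset.sum_mul, ← Finset.sum_filter, ← Finset.sum_filter]
    have q₀ := mul_le_mul_of_nonneg_right hVone hE₀
    have q₁ := mul_le_mul_of_nonneg_right hl hE₁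
    have q₂ := mul_le_mul_of_nonneg_right hr hE₂
    linarith
  exact mul_le_mul (inv_le_of_inv_le₀ hc hV) hsum (norm_nonneg _) hc.le

end Network

/-! ### The pointwise estimate -/

section Pointwise

variable {a b α β : ℝ} {f : ℝ → X} {m n : ℕ}

theorem norm_netOp_sub_le_caputo [CompleteSpace X] (hab : a < b) (hα0 : 0 < α) (hα1 : α < 1)
    (hβ1 : β < 1) (hf : ContDiffOn ℝ 1 f (Icc a b)) (hm : 1 ≤ m)
    (hn : 2 < (n : ℝ) ^ (1 - β)) (hnab : ⌈(n : ℝ) * a⌉ ≤ ⌊(n : ℝ) * b⌋) {x : ℝ}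
    (hx : x ∈ Icc a b) :
    ‖netOp m a b n f x - f x‖ ≤
      2 * (1 + (4 : ℝ) ^ m) ^ (1 / (2 * (m : ℝ))) / Real.Gamma (α + 1) *
        ((modulus (rightCaputo a b α f x) (1 / (n : ℝ) ^ β) (Icc a x)
            + modulus (leftCaputo a b α f x) (1 / (n : ℝ) ^ β) (Icc x b))
              / (n : ℝ) ^ (α * β)
          + 1 / (4 * (m : ℝ) * ((n : ℝ) ^ (1 - β) - 2) ^ (2 * m)) *
            (supNorm (rightCaputo a b α f x) (Icc a x) * (x - a) ^ α
              + supNorm (leftCaputo a b α f x) (Icc x b) * (b - x) ^ α)) := by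
  obtain ⟨B, -, hB⟩ := exists_bound_caputo hα0 hα1 hab hf
  obtain ⟨hBr, hBl⟩ := hB x hx
  -- For `n = 0` the power `0 ^ (1 - β)` is `0`, contradicting `hn`.
  have hn0 : (0 : ℝ) < n := by
    rcases Nat.eq_zero_or_pos n with h | h
    · rw [h, Nat.cast_zero, Real.zero_rpow (by linarith)] at hn
      linarith
    · exact_mod_cast h
  have hΓ : 0 < Real.Gamma (α + 1) := Real.Gamma_pos_of_pos (by linarith)
  set δ := 1 / (n : ℝ) ^ β with hδ
  set T := (n : ℝ) ^ (1 - β) with hT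
  have hδ0 : 0 < δ := by positivity
  -- Hence `|k - nx| ≤ T` means exactly `|k/n - x| ≤ δ`.
  have hTδ : T = n * δ := by
    rw [hT, hδ, Real.rpow_sub hn0, Real.rpow_one, mul_one_div]
  have hδα : δ ^ α = 1 / (n : ℝ) ^ (α * β) := by
    rw [hδ, Real.div_rpow zero_le_one (by positivity), Real.one_rpow, ← Real.rpow_mul hn0.le,
      mul_comm]
  set ωr := modulus (rightCaputo a b α f x) δ (Icc a x)
  set ωl := modulus (leftCaputo a b α f x) δ (Icc x b)
  set Sr := supNorm (rightCaputo a b α f x) (Icc a x)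
  set Sl := supNorm (leftCaputo a b α f x) (Icc x b)
  have hωr : 0 ≤ ωr := modulus_nonneg
  have hωl : 0 ≤ ωl := modulus_nonneg
  have hSr : 0 ≤ Sr := supNorm_nonneg
  have hSl : 0 ≤ Sl := supNorm_nonneg
  have hxa : 0 ≤ x - a := sub_nonneg.2 hx.1
  have hxb : 0 ≤ b - x := sub_nonneg.2 hx.2
  have hnode : ∀ k ∈ Finset.Icc ⌈(n : ℝ) * a⌉ ⌊(n : ℝ) * b⌋, (k : ℝ) / n ∈ Icc a b := by
    intro k hk
    rw [Finset.mem_Icc] at hk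
    refine ⟨(le_div_iff₀ hn0).2 ?_, (div_le_iff₀ hn0).2 ?_⟩
    · rw [mul_comm]; exact Int.ceil_le.1 hk.1
    · rw [mul_comm]; exact Int.le_floor.1 hk.2
  have hfarr : ∀ y ∈ Icc a x, ‖f y - f x‖ ≤ Sr * (x - a) ^ α / Real.Gamma (α + 1) := by
    intro y hy
    refine (norm_sub_le_of_rightCaputo_le hα0 hα1 hab hf hy.1 hy.2 hx.2 (C := Sr)
      fun J hJ => norm_le_supNorm hBr ⟨hy.1.trans hJ.1, hJ.2⟩).trans ?_
    have := Real.rpow_le_rpow (sub_nonneg.2 hy.2) (sub_le_sub_left hy.1 x) hα0.le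
    gcongr
  have hfarl : ∀ y ∈ Icc x b, ‖f y - f x‖ ≤ Sl * (b - x) ^ α / Real.Gamma (α + 1) := by
    intro y hy
    refine (norm_sub_le_of_leftCaputo_le hα0 hα1 hab hf hx.1 hy.1 hy.2 (C := Sl)
      fun J hJ => norm_le_supNorm hBl ⟨hJ.1, hJ.2.trans hy.2⟩).trans ?_
    have := Real.rpow_le_rpow (sub_nonneg.2 hy.1) (sub_le_sub_right hy.2 x) hα0.le
    gcongr
  -- Each side needs only its own modulus; the sum covers both sides at once.
  have hnear : ∀ y ∈ Icc a b, |y - x| ≤ δ →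
      ‖f y - f x‖ ≤ (ωr + ωl) * δ ^ α / Real.Gamma (α + 1) := by
    intro y hy hyx
    obtain ⟨h1, h2⟩ := abs_le.1 hyx
    rcases le_total y x with h | h
    · refine (norm_sub_le_of_rightCaputo_le hα0 hα1 hab hf hy.1 h hx.2 (C := ωr + ωl)
        fun J hJ => ?_).trans ?_
      · have := norm_sub_le_modulus (δ := δ) hBr (y := J) (z := x) ⟨hy.1.trans hJ.1, hJ.2⟩
          ⟨hx.1, le_rfl⟩ (abs_le.2 ⟨by linarith [hJ.1], by linarith [hJ.2]⟩)
        rw [rightCaputo_self, sub_zero] at this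
        linarith
      · have := Real.rpow_le_rpow (sub_nonneg.2 h) (show x - y ≤ δ by linarith) hα0.le
        gcongr
    · refine (norm_sub_le_of_leftCaputo_le hα0 hα1 hab hf hx.1 h hy.2 (C := ωr + ωl)
        fun J hJ => ?_).trans ?_
      · have := norm_sub_le_modulus (δ := δ) hBl (y := J) (z := x) ⟨hJ.1, hJ.2.trans hy.2⟩
          ⟨le_rfl, hx.2⟩ (abs_le.2 ⟨by linarith [hJ.1], by linarith [hJ.2]⟩)
        rw [leftCaputo_self, sub_zero] at this
        linarith
      · have := Real.rpow_le_rpow (sub_nonneg.2 h) h2 hα0.le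
        gcongr
  have hT0 : 0 < T := by linarith
  refine (norm_netOp_sub_le hm hnab hx hn (E₀ := (ωr + ωl) * δ ^ α / Real.Gamma (α + 1))
    (E₁ := Sr * (x - a) ^ α / Real.Gamma (α + 1)) (E₂ := Sl * (b - x) ^ α / Real.Gamma (α + 1))
    (by positivity) (by positivity) (by positivity) ?_ ?_ ?_).trans_eq ?_
  · intro k hk hkT
    refine hnear _ (hnode k hk) ?_
    have : (k : ℝ) / n - x = ((k : ℝ) - n * x) / n := by field_simp
    rw [this, abs_div, abs_of_pos hn0, div_le_iff₀ hn0, mul_comm δ, ← hTδ]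
    exact hkT
  · intro k hk hkT
    refine hfarr _ ⟨(hnode k hk).1, (div_le_iff₀ hn0).2 ?_⟩
    linarith
  · intro k hk hkT
    refine hfarl _ ⟨(le_div_iff₀ hn0).2 ?_, (hnode k hk).2⟩
    linarith
  · rw [hδα]
    ring

end Pointwise

end Approximation

end

/-! ### Pointwise and uniform bounds together -/

theorem theorem31 {X : Type*} [NormedAddCommGroup X] [NormedSpace ℝ X] [CompleteSpace X]
    (a b : ℝ) (hab : a < b) (α β : ℝ) (hα0 : 0 < α) (hα1 : α < 1) (hβ0 : 0 < β) (hβ1 : β < 1)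
    (f : ℝ → X) (hf : ContDiffOn ℝ 1 f (Set.Icc a b))
    (m : ℕ) (hm : 1 ≤ m) (n : ℕ) (hn : 2 < (n : ℝ) ^ (1 - β))
    (hnab : ⌈(n : ℝ) * a⌉ ≤ ⌊(n : ℝ) * b⌋) :
    -- pointwise bound; the suprema in it are finite
    (∀ x ∈ Set.Icc a b,
      BddAbove (oscValues (rightCaputo a b α f x) (1 / (n : ℝ) ^ β) (Set.Icc a x)) ∧
      BddAbove (oscValues (leftCaputo a b α f x) (1 / (n : ℝ) ^ β) (Set.Icc x b)) ∧
      BddAbove (normValues (rightCaputo a b α f x) (Set.Icc a x)) ∧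
      BddAbove (normValues (leftCaputo a b α f x) (Set.Icc x b)) ∧
      ‖netOp m a b n f x - f x‖ ≤
        2 * (1 + (4 : ℝ) ^ m) ^ (1 / (2 * (m : ℝ))) / Real.Gamma (α + 1) *
          ((modulus (rightCaputo a b α f x) (1 / (n : ℝ) ^ β) (Set.Icc a x)
              + modulus (leftCaputo a b α f x) (1 / (n : ℝ) ^ β) (Set.Icc x b))
                / (n : ℝ) ^ (α * β)
            + 1 / (4 * (m : ℝ) * ((n : ℝ) ^ (1 - β) - 2) ^ (2 * m)) *
              (supNorm (rightCaputo a b α f x) (Set.Icc a x) * (x - a) ^ α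
                + supNorm (leftCaputo a b α f x) (Set.Icc x b) * (b - x) ^ α))) ∧
    -- uniform bound; the suprema in it are finite
    (BddAbove ((fun x => modulus (rightCaputo a b α f x) (1 / (n : ℝ) ^ β) (Set.Icc a x)) ''
        Set.Icc a b) ∧
      BddAbove ((fun x => modulus (leftCaputo a b α f x) (1 / (n : ℝ) ^ β) (Set.Icc x b)) ''
        Set.Icc a b) ∧
      BddAbove ((fun x => supNorm (rightCaputo a b α f x) (Set.Icc a x)) '' Set.Icc a b) ∧
      BddAbove ((fun x => supNorm (leftCaputo a b α f x) (Set.Icc x b)) '' Set.Icc a b) ∧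
      BddAbove (normValues (fun x => netOp m a b n f x - f x) (Set.Icc a b)) ∧
      supNorm (fun x => netOp m a b n f x - f x) (Set.Icc a b) ≤
        2 * (1 + (4 : ℝ) ^ m) ^ (1 / (2 * (m : ℝ))) / Real.Gamma (α + 1) *
          ((sSup ((fun x => modulus (rightCaputo a b α f x) (1 / (n : ℝ) ^ β) (Set.Icc a x)) ''
                Set.Icc a b)
              + sSup ((fun x => modulus (leftCaputo a b α f x) (1 / (n : ℝ) ^ β) (Set.Icc x b)) ''
                Set.Icc a b))
                / (n : ℝ) ^ (α * β)
            + (b - a) ^ α / (4 * (m : ℝ) * ((n : ℝ) ^ (1 - β) - 2) ^ (2 * m)) *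
              (sSup ((fun x => supNorm (rightCaputo a b α f x) (Set.Icc a x)) '' Set.Icc a b)
                + sSup ((fun x => supNorm (leftCaputo a b α f x) (Set.Icc x b)) ''
                  Set.Icc a b)))) := by
  obtain ⟨B, hB0, hB⟩ := exists_bound_caputo hα0 hα1 hab hf
  have hpt := fun x (hx : x ∈ Set.Icc a b) =>
    norm_netOp_sub_le_caputo hab hα0 hα1 hβ1 hf hm hn hnab hx
  have hbr : BddAbove ((fun x => modulus (rightCaputo a b α f x) (1 / (n : ℝ) ^ β) (Set.Icc a x)) ''
      Set.Icc a b) := ⟨B + B, by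
    rintro _ ⟨x, hx, rfl⟩; exact modulus_le (hB x hx).1 hB0⟩
  have hbl : BddAbove ((fun x => modulus (leftCaputo a b α f x) (1 / (n : ℝ) ^ β) (Set.Icc x b)) ''
      Set.Icc a b) := ⟨B + B, by
    rintro _ ⟨x, hx, rfl⟩; exact modulus_le (hB x hx).2 hB0⟩
  have hsr : BddAbove ((fun x => supNorm (rightCaputo a b α f x) (Set.Icc a x)) '' Set.Icc a b) :=
    ⟨B, by rintro _ ⟨x, hx, rfl⟩; exact supNorm_le (Set.nonempty_Icc.2 hx.1) (hB x hx).1⟩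
  have hsl : BddAbove ((fun x => supNorm (leftCaputo a b α f x) (Set.Icc x b)) '' Set.Icc a b) :=
    ⟨B, by rintro _ ⟨x, hx, rfl⟩; exact supNorm_le (Set.nonempty_Icc.2 hx.2) (hB x hx).2⟩
  have hunif : ∀ x ∈ Set.Icc a b, ‖netOp m a b n f x - f x‖ ≤
        2 * (1 + (4 : ℝ) ^ m) ^ (1 / (2 * (m : ℝ))) / Real.Gamma (α + 1) *
          ((sSup ((fun x => modulus (rightCaputo a b α f x) (1 / (n : ℝ) ^ β) (Set.Icc a x)) ''
                Set.Icc a b)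
              + sSup ((fun x => modulus (leftCaputo a b α f x) (1 / (n : ℝ) ^ β) (Set.Icc x b)) ''
                Set.Icc a b))
                / (n : ℝ) ^ (α * β)
            + (b - a) ^ α / (4 * (m : ℝ) * ((n : ℝ) ^ (1 - β) - 2) ^ (2 * m)) *
              (sSup ((fun x => supNorm (rightCaputo a b α f x) (Set.Icc a x)) '' Set.Icc a b)
                + sSup ((fun x => supNorm (leftCaputo a b α f x) (Set.Icc x b)) ''
                  Set.Icc a b))) := by
    intro x hx
    refine (hpt x hx).trans ?_
    have hΓ : 0 < Real.Gamma (α + 1) := Real.Gamma_pos_of_pos (by linarith)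
    have hT : 0 < (n : ℝ) ^ (1 - β) - 2 := by linarith
    have h1 := le_csSup hbr (Set.mem_image_of_mem _ hx)
    have h2 := le_csSup hbl (Set.mem_image_of_mem _ hx)
    have h3 := le_csSup hsr (Set.mem_image_of_mem _ hx)
    have h4 := le_csSup hsl (Set.mem_image_of_mem _ hx)
    have h5 := Real.rpow_le_rpow (sub_nonneg.2 hx.1) (sub_le_sub_right hx.2 a) hα0.le
    have h6 := Real.rpow_le_rpow (sub_nonneg.2 hx.2) (sub_le_sub_left hx.1 b) hα0.le
    have h7 : 0 ≤ (b - a) ^ α := Real.rpow_nonneg (by linarith) _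
    -- The powers of `x - a` and `b - x` are each replaced by `(b - a)^α`, which then factors out.
    have h8 := mul_le_mul h3 h5 (Real.rpow_nonneg (sub_nonneg.2 hx.1) _)
      (supNorm_nonneg.trans h3)
    have h9 := mul_le_mul h4 h6 (Real.rpow_nonneg (sub_nonneg.2 hx.2) _)
      (supNorm_nonneg.trans h4)
    refine mul_le_mul_of_nonneg_left (add_le_add (div_le_div_of_nonneg_right (add_le_add h1 h2)
      (by positivity)) ?_) (by positivity)
    refine (mul_le_mul_of_nonneg_left (add_le_add h8 h9) (by positivity)).trans_eq ?_
    ring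
  exact ⟨fun x hx => ⟨bddAbove_oscValues (hB x hx).1, bddAbove_oscValues (hB x hx).2,
    bddAbove_normValues (hB x hx).1, bddAbove_normValues (hB x hx).2, hpt x hx⟩,
    hbr, hbl, hsr, hsl, bddAbove_normValues hunif, supNorm_le (Set.nonempty_Icc.2 hab.le) hunif⟩
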